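/- Let $C_1,C_2$ be finite sets of clocks, $Act$ a finite set of actions, and let $A_1,A_2$ be timed automata over $C_1,Act$ and $C_2,Act$: $A=(L,l_0,E,I)$ has a finite set $L$ of locations, an initial location $l_0$, a finite set $E$ of edges $l\xrightarrow{g,a,r}l'$, and invariants $I(l)$; guards and invariants are non-empty finite conjunctions of constraints $x\smile c$ with $c\in\mathbb N$, $\smile\;\in\{\le,<,=,\ge,>\}$. The processes of $A$ are the pairs $(l,v)$ with $v:C\to\mathbb R_{\ge0}$ and $v\models I(l)$; the transitions between processes are $(l,v)\xrightarrow{a}(l',v[r])$ for an edge $l\xrightarrow{g,a,r}l'$ with $v\models g$, and $(l,v)\xrightarrow{d}(l,v+d)$ for $d\in\mathbb R_{\ge0}$. Time abstracted bisimilarity $p\sim_u q$ is the largest relation such that each $a$-transition of one process is matched by an $a$-transition of the other, and each delay transition of one by a delay transition of the other (of a possibly different duration), the targets being related again. A zone is a finite union of sets of valuations, each defined by a finite conjunction of constraints $x\smile c$ and $x-y\smile c$ with integer $c$. Call a graph with edge labels in $Lep=Act\cup\{\varepsilon\}$, whose nodes are pairs of a set of locations and a zone and which has a distinguished initial node, a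 representation of a process $p$ of $A$ if the following holds, where a process $(l,v)$ lies in a node if $l$ belongs to its location set and $v$ to its zone, and $\mathcal G(s)$ is the set of the processes reachable from $p$ that lie in $s$: 1. there are finitely many nodes, and every zone is convex; 2. $p$ lies in the initial node, and every process reachable from $p$ lies in exactly one node; 3. any two processes of $A$ that lie in the same node are time abstracted bisimilar; 4. $s\xrightarrow{a}t$ iff $r\xrightarrow{a}r'$ for some $r\in\mathcal G(s)$, $r'\in\mathcal G(t)$; and $\xrightarrow{\varepsilon}$ is the reflexive transitive closure of the relation "$r\xrightarrow{d}r'$ for some $r\in\mathcal G(s)$, $r'\in\mathcal G(t)$, $d\ge0$"; 5. every node is reachable from the initial node. A zone valuation graph of $p$ is a minimal representation $Z$ of $p$: whenever $Z'$ is a representation of $p$ and $f$ maps the nodes of $Z$ to nodes of $Z'$ with $\mathcal G(s)\subseteq\mathcal G(f(s))$ for all $s$, then $f$ is injective. In the game $\Gamma^{Z,\langle a,a\rangle}_\infty$ ($a\in Lep$) on zone valuation graphs $Z_1,Z_2$, a position is a pair of nodes, one from each graph, and the play starts at the pair of initial nodes. In each round the attacker chooses one of the two graphs (freely in each round) and moves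 along an edge of it, with some label $a\in Lep$, from the current node; the defender has to move along an edge with the same label in the other graph from the current node there. The number of rounds is unbounded; the defender loses if it cannot answer some move and wins otherwise. **Lemma (Time Abstracted Bisimulation Game).** Every process of $A_1$ and every process of $A_2$ has a zone valuation graph. For all processes $p$ of $A_1$ and $q$ of $A_2$ and all zone valuation graphs $Z_1$ of $p$ and $Z_2$ of $q$, the defender has a winning strategy in the game $\Gamma^{Z,\langle a,a\rangle}_\infty$ on $Z_1$ and $Z_2$ if and only if $p\sim_u q$. -/

import Mathlib

open scoped NNReal

/-! ### Clock constraints and timed automata -/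

/-- The comparison symbols `≤, <, =, ≥, >`. -/
inductive Cmp where
  | le | lt | eq | ge | gt

/-- Meaning of a comparison symbol on real numbers. -/
def Cmp.Holds : Cmp → ℝ → ℝ → Prop
  | .le, a, b => a ≤ b
  | .lt, a, b => a < b
  | .eq, a, b => a = b
  | .ge, a, b => a ≥ b
  | .gt, a, b => a > b

/-- Clock valuations `C → ℝ≥0`. -/
abbrev ClockVal (C : Type*) := C → ℝ≥0

/-- The clock constraints `g ::= x ⌣ c | g ∧ g` over the clocks `C`, with `c ∈ ℕ`. -/
inductive ClockConstraint (C : Type*) where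
  | atom (x : C) (r : Cmp) (c : ℕ) : ClockConstraint C
  | and (g h : ClockConstraint C) : ClockConstraint C

/-- `g.Sat v` : the valuation `v` satisfies the clock constraint `g`. -/
def ClockConstraint.Sat {C : Type*} : ClockConstraint C → ClockVal C → Prop
  | .atom x r c, v => r.Holds (v x : ℝ) (c : ℝ)
  | .and g h, v => g.Sat v ∧ h.Sat v

/-- `v + d` : every clock is incremented by `d`. -/
noncomputable def ClockVal.delay {C : Type*} (v : ClockVal C) (d : ℝ≥0) : ClockVal C :=
  fun x => v x + d

open Classical in
/-- `v[r]` : the clocks in `r` are reset to zero. -/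
noncomputable def ClockVal.reset {C : Type*} (v : ClockVal C) (r : Set C) : ClockVal C :=
  fun x => if x ∈ r then 0 else v x

/-- An edge `l —g,a,r→ l'` of a timed automaton. -/
structure TAEdge (L C Act : Type*) where
  source : L
  guard : ClockConstraint C
  action : Act
  resets : Set C
  target : L

/-- A timed automaton `(L, l₀, E, I)` over the clocks `C` and the actions `Act`.
(Finiteness of `L`, `C` and `Act` is assumed where automata are used.) -/
structure TimedAutomaton (L C Act : Type*) where
  initLoc : L
  edges : Set (TAEdge L C Act)
  edges_finite : edges.Finite
  inv : L → ClockConstraint C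

namespace TimedAutomaton

variable {L C Act : Type*}

/-- The processes (states) of the timed transition system `T(A)`: pairs `(l, v)` with
`v ⊨ I(l)`. -/
structure Proc (A : TimedAutomaton L C Act) where
  loc : L
  val : ClockVal C
  sat_inv : (A.inv loc).Sat val

/-- Action transitions `(l, v) —a→ (l', v')` of `T(A)`; the condition `v' ⊨ I(l')` holds
because `(l', v')` is a process. -/
def ActStep (A : TimedAutomaton L C Act) (p : A.Proc) (a : Act) (p' : A.Proc) : Prop :=
  ∃ e ∈ A.edges, e.source = p.loc ∧ e.action = a ∧ e.target = p'.loc ∧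
    e.guard.Sat p.val ∧ p'.val = p.val.reset e.resets

/-- Delay transitions `(l, v) —d→ (l, v + d)` of `T(A)`; both ends satisfy `I(l)` because they
are processes. -/
def DelayStep (A : TimedAutomaton L C Act) (p : A.Proc) (d : ℝ≥0) (p' : A.Proc) : Prop :=
  p'.loc = p.loc ∧ p'.val = p.val.delay d

/-- `A.Reachable p r` : `r` is reachable from `p` in `T(A)` by finitely many transitions. -/
def Reachable (A : TimedAutomaton L C Act) : A.Proc → A.Proc → Prop :=
  Relation.ReflTransGen fun r r' => (∃ a, A.ActStep r a r') ∨ ∃ d, A.DelayStep r d r'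

end TimedAutomaton

/-! ### Time abstracted bisimilarity -/

/-- `R` is a time abstracted bisimulation between the processes of `A₁` and those of `A₂`:
actions are matched by equal actions, delays by arbitrary delays. -/
structure IsTimeAbstractedBisimulation {L₁ C₁ L₂ C₂ Act : Type*}
    (A₁ : TimedAutomaton L₁ C₁ Act) (A₂ : TimedAutomaton L₂ C₂ Act)
    (R : A₁.Proc → A₂.Proc → Prop) : Prop where
  act_left : ∀ p q, R p q → ∀ a p', A₁.ActStep p a p' → ∃ q', A₂.ActStep q a q' ∧ R p' q'
  act_right : ∀ p q, R p q → ∀ a q', A₂.ActStep q a q' → ∃ p', A₁.ActStep p a p' ∧ R p' q'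
  delay_left : ∀ p q, R p q → ∀ d p', A₁.DelayStep p d p' →
    ∃ d' q', A₂.DelayStep q d' q' ∧ R p' q'
  delay_right : ∀ p q, R p q → ∀ d q', A₂.DelayStep q d q' →
    ∃ d' p', A₁.DelayStep p d' p' ∧ R p' q'

/-- Time abstracted bisimilarity `p ∼ᵤ q`. -/
def TimeAbstractedBisimilar {L₁ C₁ L₂ C₂ Act : Type*}
    {A₁ : TimedAutomaton L₁ C₁ Act} {A₂ : TimedAutomaton L₂ C₂ Act}
    (p : A₁.Proc) (q : A₂.Proc) : Prop :=
  ∃ R : A₁.Proc → A₂.Proc → Prop, IsTimeAbstractedBisimulation A₁ A₂ R ∧ R p q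

/-! ### Zones -/

/-- The atoms of linear formulas: clock constraints `x ⌣ c` and diagonal constraints
`x - y ⌣ c`. -/
inductive ZoneAtom (C : Type*) where
  | clock (x : C) (r : Cmp) (c : ℕ) : ZoneAtom C
  | diag (x y : C) (r : Cmp) (c : ℤ) : ZoneAtom C

/-- Satisfaction of an atom by a valuation. -/
def ZoneAtom.Sat {C : Type*} : ZoneAtom C → ClockVal C → Prop
  | .clock x r c, v => r.Holds (v x : ℝ) (c : ℝ)
  | .diag x y r c, v => r.Holds ((v x : ℝ) - (v y : ℝ)) (c : ℝ)

/-- A zone is a finite union of characteristic sets of linear formulas, a linear formula being a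
finite conjunction of atoms. -/
def IsZone {C : Type*} (Z : Set (ClockVal C)) : Prop :=
  ∃ F : List (List (ZoneAtom C)), Z = {v | ∃ φ ∈ F, ∀ g ∈ φ, g.Sat v}

/-! ### Zone graphs and zone valuation graphs -/

/-- The labels `Lep = Act ∪ {ε}`. -/
inductive Lep (Act : Type*) where
  | act (a : Act) : Lep Act
  | eps : Lep Act

/-- A node of a zone graph: a set of locations (a singleton, unless nodes with different locations
have been combined) and a set of valuations. -/
structure ZoneNode (L C : Type*) where
  locs : Set L
  zone : Set (ClockVal C)

/-- A graph `(S, s₀, Lep, →)` whose nodes consist of locations and zones. -/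
structure ZoneGraph (L C Act : Type*) where
  nodes : Set (ZoneNode L C)
  init : nodes
  step : nodes → Lep Act → nodes → Prop
  isZone : ∀ s ∈ nodes, IsZone s.zone

namespace ZoneNode

variable {L C Act : Type*}

/-- The process `r` lies in the node `s`. -/
def Contains (s : ZoneNode L C) {A : TimedAutomaton L C Act} (r : A.Proc) : Prop :=
  r.loc ∈ s.locs ∧ r.val ∈ s.zone

/-- `𝒢(s)`: the processes reachable from `p` that lie in the node `s`. -/
def procs (s : ZoneNode L C) {A : TimedAutomaton L C Act} (p : A.Proc) : Set A.Proc :=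
  {r | A.Reachable p r ∧ s.Contains r}

end ZoneNode

/-- `Z` is a finite zone graph with convex zones that represents the part of `T(A)` reachable
from the process `p`, each node being contained in one class of time abstracted bisimilarity. -/
structure Represents {L C Act : Type*} (A : TimedAutomaton L C Act) (p : A.Proc)
    (Z : ZoneGraph L C Act) : Prop where
  /-- There are finitely many nodes. -/
  finite : Z.nodes.Finite
  /-- The zone of each node is convex. -/
  convex : ∀ s ∈ Z.nodes, Convex ℝ≥0 s.zone
  /-- The initial node contains `p`. -/
  init_contains : Z.init.1.Contains p
  /-- Any two processes in the same node are time abstracted bisimilar. -/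
  bisimilar : ∀ s ∈ Z.nodes, ∀ r r' : A.Proc, s.Contains r → s.Contains r' →
    TimeAbstractedBisimilar r r'
  /-- Each process reachable from `p` lies in exactly one node. -/
  cover : ∀ r, A.Reachable p r → ∃! s : Z.nodes, s.1.Contains r
  /-- The `a`-edges are those induced by the `a`-transitions of the represented processes. -/
  step_act : ∀ (s t : Z.nodes) (a : Act), Z.step s (.act a) t ↔
    ∃ r ∈ s.1.procs p, ∃ r' ∈ t.1.procs p, A.ActStep r a r'
  /-- The `ε`-edges are those induced by the delays of the represented processes, closed under
  reflexivity and transitivity. -/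
  step_eps : ∀ s t : Z.nodes, Z.step s .eps t ↔
    Relation.ReflTransGen (fun s' t' : Z.nodes =>
      ∃ r ∈ s'.1.procs p, ∃ r' ∈ t'.1.procs p, ∃ d, A.DelayStep r d r') s t
  /-- The graph is connected: each node is reachable from the initial one. -/
  connected : ∀ s : Z.nodes, Relation.ReflTransGen (fun s' t' => ∃ a, Z.step s' a t') Z.init s

/-- `Z` is a zone valuation graph `Z_(A,p)` of the process `p` of `A`: it represents `p` and is
minimal, that is, no such graph that is coarser than `Z` identifies two nodes of `Z`. -/
structure IsZoneValuationGraph {L C Act : Type*} (A : TimedAutomaton L C Act) (p : A.Proc)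
    (Z : ZoneGraph L C Act) : Prop where
  represents : Represents A p Z
  minimal : ∀ Z' : ZoneGraph L C Act, Represents A p Z' → ∀ f : Z.nodes → Z'.nodes,
    (∀ s, s.1.procs p ⊆ (f s).1.procs p) → Function.Injective f

/-! ### The unrestricted strong bisimulation game -/

namespace BisimGame

variable {L₁ C₁ L₂ C₂ Act : Type*} (Z₁ : ZoneGraph L₁ C₁ Act) (Z₂ : ZoneGraph L₂ C₂ Act)

/-- A position: the current node in each graph. -/
abbrev Position := Z₁.nodes × Z₂.nodes

/-- A move of the attacker: the choice of a graph, a label in `Lep` and a target node there. -/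
inductive Attack where
  | left (a : Lep Act) (s' : Z₁.nodes) : Attack
  | right (a : Lep Act) (t' : Z₂.nodes) : Attack

variable {Z₁ Z₂}

/-- The attacker has to move along an edge of the graph it chooses (a free choice in each
round). -/
def Legal (pos : Position Z₁ Z₂) : Attack Z₁ Z₂ → Prop
  | .left a s' => Z₁.step pos.1 a s'
  | .right a t' => Z₂.step pos.2 a t'

/-- `pos'` arises from `pos` when the attacker plays `m` and the defender answers by an edge with
the same label in the other graph. -/
def Answers (pos : Position Z₁ Z₂) (m : Attack Z₁ Z₂) (pos' : Position Z₁ Z₂) : Prop :=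
  match m with
  | .left a s' => pos'.1 = s' ∧ Z₂.step pos.2 a pos'.2
  | .right a t' => pos'.2 = t' ∧ Z₁.step pos.1 a pos'.1

/-- A history: the rounds so far, most recent first, each given by the position at its start and
the attacker's move in it. -/
abbrev History (Z₁ : ZoneGraph L₁ C₁ Act) (Z₂ : ZoneGraph L₂ C₂ Act) :=
  List (Position Z₁ Z₂ × Attack Z₁ Z₂)

/-- A strategy of the defender: the position after the round just opened by the attacker, as a
function of the history including that move. -/
abbrev Strategy (Z₁ : ZoneGraph L₁ C₁ Act) (Z₂ : ZoneGraph L₂ C₂ Act) :=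
  History Z₁ Z₂ → Position Z₁ Z₂

/-- `Play σ h pos` : a play from the initial nodes in which the defender follows `σ` can have
history `h` and current position `pos`. -/
inductive Play (σ : Strategy Z₁ Z₂) : History Z₁ Z₂ → Position Z₁ Z₂ → Prop
  | start : Play σ [] (Z₁.init, Z₂.init)
  | round {h : History Z₁ Z₂} {pos : Position Z₁ Z₂} {m : Attack Z₁ Z₂} :
      Play σ h pos → Legal pos m → Play σ ((pos, m) :: h) (σ ((pos, m) :: h))

/-- The defender wins with `σ` if in every play, in every one of the unboundedly many rounds, `σ`
answers each legal move of the attacker correctly. -/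
def IsWinning (σ : Strategy Z₁ Z₂) : Prop :=
  ∀ h pos m, Play σ h pos → Legal pos m → Answers pos m (σ ((pos, m) :: h))

variable (Z₁ Z₂)

/-- The defender has a winning strategy in the bisimulation game on `Z₁` and `Z₂` with moves
`⟨a, a⟩`, `a ∈ Lep`, unboundedly many rounds and alternations and no extra condition. -/
def DefenderWins : Prop :=
  ∃ σ : Strategy Z₁ Z₂, IsWinning σ

end BisimGame

/-! ### Time abstracted bisimilarity is an equivalence -/

section Bisimilarity

variable {L₁ C₁ L₂ C₂ L₃ C₃ Act : Type*} {A₁ : TimedAutomaton L₁ C₁ Act}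
  {A₂ : TimedAutomaton L₂ C₂ Act} {A₃ : TimedAutomaton L₃ C₃ Act}

/-! Existence rests on regions. Let `K` bound every constant of the automaton, and call two
valuations equivalent if they satisfy the same clock and diagonal atoms with constants up to `K`.
Equivalence survives resets (`RegionEquiv.reset`) and delays, the latter with an adjusted duration
(`RegionEquiv.exists_delay`), so processes with equal locations and equivalent valuations are time
abstracted bisimilar (`ConstBounded.bisimilar`). Only finitely many atoms are involved and each
defines a convex set, hence there are finitely many regions, all convex zones, and the reachable
ones form a representation. A representation with the fewest nodes is minimal.

The equivalence of game and bisimilarity rests on each node lying inside one bisimilarity class: an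
edge induced by one process of a node can be imitated by every process bisimilar to some process of
that node (`exists_actStep`, `exists_delayStep`). Bisimilar processes thus give the defender an
invariant, and a winning invariant, closed under bisimilarity on both sides, is a time abstracted
bisimulation. By `defenderWins_iff` strategies may be replaced by such invariants. -/

theorem timeAbstractedBisimilar_isBisimulation :
    IsTimeAbstractedBisimulation A₁ A₂ TimeAbstractedBisimilar where
  act_left := by
    rintro p q ⟨R, hR, h⟩ a p' hp
    obtain ⟨q', hq, h'⟩ := hR.act_left p q h a p' hp
    exact ⟨q', hq, R, hR, h'⟩
  act_right := by
    rintro p q ⟨R, hR, h⟩ a q' hq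
    obtain ⟨p', hp, h'⟩ := hR.act_right p q h a q' hq
    exact ⟨p', hp, R, hR, h'⟩
  delay_left := by
    rintro p q ⟨R, hR, h⟩ d p' hp
    obtain ⟨d', q', hq, h'⟩ := hR.delay_left p q h d p' hp
    exact ⟨d', q', hq, R, hR, h'⟩
  delay_right := by
    rintro p q ⟨R, hR, h⟩ d q' hq
    obtain ⟨d', p', hp, h'⟩ := hR.delay_right p q h d q' hq
    exact ⟨d', p', hp, R, hR, h'⟩

theorem IsTimeAbstractedBisimulation.flip {R : A₁.Proc → A₂.Proc → Prop}
    (hR : IsTimeAbstractedBisimulation A₁ A₂ R) :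
    IsTimeAbstractedBisimulation A₂ A₁ (fun q p => R p q) where
  act_left p q h := hR.act_right q p h
  act_right p q h := hR.act_left q p h
  delay_left p q h := hR.delay_right q p h
  delay_right p q h := hR.delay_left q p h

theorem TimeAbstractedBisimilar.symm {p : A₁.Proc} {q : A₂.Proc}
    (h : TimeAbstractedBisimilar p q) : TimeAbstractedBisimilar q p := by
  obtain ⟨R, hR, h⟩ := h
  exact ⟨_, hR.flip, h⟩

theorem TimeAbstractedBisimilar.refl (p : A₁.Proc) : TimeAbstractedBisimilar p p := by
  refine ⟨Eq, ⟨?_, ?_, ?_, ?_⟩, rfl⟩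
  · rintro p _ rfl a p' h
    exact ⟨p', h, rfl⟩
  · rintro p _ rfl a p' h
    exact ⟨p', h, rfl⟩
  · rintro p _ rfl d p' h
    exact ⟨d, p', h, rfl⟩
  · rintro p _ rfl d p' h
    exact ⟨d, p', h, rfl⟩

theorem TimeAbstractedBisimilar.trans {p : A₁.Proc} {q : A₂.Proc} {r : A₃.Proc}
    (h : TimeAbstractedBisimilar p q) (h' : TimeAbstractedBisimilar q r) :
    TimeAbstractedBisimilar p r := by
  obtain ⟨R, hR, h⟩ := h
  obtain ⟨S, hS, h'⟩ := h'
  refine ⟨fun p r => ∃ q, R p q ∧ S q r, ⟨?_, ?_, ?_, ?_⟩, q, h, h'⟩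
  · rintro p r ⟨q, h, h'⟩ a p' hp
    obtain ⟨q', hq, h1⟩ := hR.act_left p q h a p' hp
    obtain ⟨r', hr, h2⟩ := hS.act_left q r h' a q' hq
    exact ⟨r', hr, q', h1, h2⟩
  · rintro p r ⟨q, h, h'⟩ a r' hr
    obtain ⟨q', hq, h1⟩ := hS.act_right q r h' a r' hr
    obtain ⟨p', hp, h2⟩ := hR.act_right p q h a q' hq
    exact ⟨p', hp, q', h2, h1⟩
  · rintro p r ⟨q, h, h'⟩ d p' hp
    obtain ⟨d', q', hq, h1⟩ := hR.delay_left p q h d p' hp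
    obtain ⟨d'', r', hr, h2⟩ := hS.delay_left q r h' d' q' hq
    exact ⟨d'', r', hr, q', h1, h2⟩
  · rintro p r ⟨q, h, h'⟩ d r' hr
    obtain ⟨d', q', hq, h1⟩ := hS.delay_right q r h' d r' hr
    obtain ⟨d'', p', hp, h2⟩ := hR.delay_right p q h d' q' hq
    exact ⟨d'', p', hp, q', h2, h1⟩

end Bisimilarity

/-! ### Transitions between processes -/

namespace TimedAutomaton

variable {L C Act : Type*} {A : TimedAutomaton L C Act}

theorem DelayStep.zero (p : A.Proc) : A.DelayStep p 0 p :=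
  ⟨rfl, by funext x; simp [ClockVal.delay]⟩

theorem DelayStep.trans {p q r : A.Proc} {d e : ℝ≥0} (h : A.DelayStep p d q)
    (h' : A.DelayStep q e r) : A.DelayStep p (d + e) r :=
  ⟨h'.1.trans h.1, by rw [h'.2, h.2]; funext x; simp [ClockVal.delay, add_assoc]⟩

theorem Reachable.act {p q r : A.Proc} {a : Act} (h : A.Reachable p q) (h' : A.ActStep q a r) :
    A.Reachable p r :=
  Relation.ReflTransGen.tail h (Or.inl ⟨a, h'⟩)

theorem Reachable.delay {p q r : A.Proc} {d : ℝ≥0} (h : A.Reachable p q)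
    (h' : A.DelayStep q d r) : A.Reachable p r :=
  Relation.ReflTransGen.tail h (Or.inr ⟨d, h'⟩)

end TimedAutomaton

/-! ### Regions -/

section OrderMatching

/-- A point can be placed relative to a finite family of reals as a given point is placed
relative to an equally ordered family. -/
theorem exists_same_position {ι : Type*} [Finite ι] {f g : ι → ℝ}
    (hfg : ∀ i j, f i ≤ f j ↔ g i ≤ g j) (d : ℝ) :
    ∃ d', ∀ i, (f i ≤ d ↔ g i ≤ d') ∧ (d ≤ f i ↔ d' ≤ g i) := by
  classical
  cases nonempty_fintype ι
  by_cases hd : ∃ i, f i = d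
  · obtain ⟨i, rfl⟩ := hd
    exact ⟨g i, fun j => ⟨hfg j i, hfg i j⟩⟩
  · push Not at hd
    -- If `f i < d < f j` then `g i < g j`, so the two finite images are separated and some real
    -- lies strictly between them, even if one is empty.
    obtain ⟨m, hlo, hhi⟩ := Order.exists_between_finsets
      ((Finset.univ.filter fun i => f i < d).image g)
      ((Finset.univ.filter fun i => d < f i).image g) (by
        simp only [Finset.mem_image, Finset.mem_filter, Finset.mem_univ, true_and]
        rintro _ ⟨i, hi, rfl⟩ _ ⟨j, hj, rfl⟩
        exact lt_of_not_ge fun h => absurd ((hfg j i).2 h) (not_le.2 (hi.trans hj)))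
    refine ⟨m, fun i => ?_⟩
    rcases lt_or_gt_of_ne (hd i) with h | h
    · have := hlo (g i) (Finset.mem_image_of_mem g (by simpa using h))
      exact ⟨iff_of_true h.le this.le, iff_of_false h.not_ge this.not_ge⟩
    · have := hhi (g i) (Finset.mem_image_of_mem g (by simpa using h))
      exact ⟨iff_of_false h.not_ge this.not_ge, iff_of_true h.le this.le⟩

end OrderMatching

/-- Every comparison symbol is a Boolean combination of `≤` and `≥`. -/
theorem Cmp.holds_congr {a b a' b' : ℝ} (h : a ≤ b ↔ a' ≤ b') (h' : b ≤ a ↔ b' ≤ a') (r : Cmp) :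
    r.Holds a b ↔ r.Holds a' b' := by
  cases r with
  | le => exact h
  | lt => simpa [Cmp.Holds] using not_congr h'
  | eq => simp only [Cmp.Holds, le_antisymm_iff, h, h']
  | ge => exact h'
  | gt => simpa [Cmp.Holds] using not_congr h

theorem Cmp.convex_holds (r : Cmp) (c : ℝ) : Convex ℝ {u | r.Holds u c} := by
  cases r with
  | le => exact convex_Iic c
  | lt => exact convex_Iio c
  | eq => exact convex_singleton c
  | ge => exact convex_Ici c
  | gt => exact convex_Ioi c

instance Cmp.instFinite : Finite Cmp :=
  (Set.toFinite ({.le, .lt, .eq, .ge, .gt} : Set Cmp)).subset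
    (fun r _ => by cases r <;> simp) |> Set.finite_univ_iff.1

/-- The largest constant of a clock constraint. -/
def ClockConstraint.maxConst {C : Type*} : ClockConstraint C → ℕ
  | .atom _ _ c => c
  | .and g h => max g.maxConst h.maxConst

/-- All constants of the atom are at most `K` in absolute value. -/
def ZoneAtom.Bounded {C : Type*} (K : ℕ) : ZoneAtom C → Prop
  | .clock _ _ c => c ≤ K
  | .diag _ _ _ c => |c| ≤ K

theorem ZoneAtom.finite_bounded {C : Type*} [Finite C] (K : ℕ) :
    {g : ZoneAtom C | g.Bounded K}.Finite := by
  refine ((Set.finite_range fun t : C × Cmp × Set.Iic K =>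
    ZoneAtom.clock t.1 t.2.1 (t.2.2 : ℕ)).union (Set.finite_range
      fun t : C × C × Cmp × Set.Icc (-(K : ℤ)) K =>
        ZoneAtom.diag t.1 t.2.1 t.2.2.1 (t.2.2.2 : ℤ))).subset ?_
  rintro (⟨x, r, c⟩ | ⟨x, y, r, c⟩) hg
  · exact Or.inl ⟨(x, r, ⟨c, hg⟩), rfl⟩
  · exact Or.inr ⟨(x, y, r, ⟨c, abs_le.1 hg⟩), rfl⟩

theorem ZoneAtom.convex_sat {C : Type*} (g : ZoneAtom C) : Convex ℝ≥0 {v | g.Sat v} := by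
  intro v hv w hw a b _ _ hab
  have hab' : (a : ℝ) + b = 1 := by exact_mod_cast hab
  cases g with
  | clock x r c =>
    have := Cmp.convex_holds r c hv hw a.2 b.2 hab'
    simpa [ZoneAtom.Sat] using this
  | diag x y r c =>
    have := Cmp.convex_holds r c hv hw a.2 b.2 hab'
    have e : (a : ℝ) • ((v x : ℝ) - v y) + (b : ℝ) • ((w x : ℝ) - w y)
        = ((a • v + b • w) x : ℝ≥0) - ((a • v + b • w) y : ℝ≥0) := by
      simp only [smul_eq_mul, Pi.add_apply, Pi.smul_apply, NNReal.coe_add, NNReal.coe_mul]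
      ring
    change r.Holds _ _
    rw [← e]
    exact this

/-- Two valuations are region equivalent if they satisfy the same atoms with constants up
to `K`. -/
def RegionEquiv {C : Type*} (K : ℕ) (v w : ClockVal C) : Prop :=
  ∀ g : ZoneAtom C, g.Bounded K → (g.Sat v ↔ g.Sat w)

namespace RegionEquiv

variable {C : Type*} {K : ℕ} {v w : ClockVal C}

theorem refl (v : ClockVal C) : RegionEquiv K v v := fun _ _ => Iff.rfl

theorem symm (h : RegionEquiv K v w) : RegionEquiv K w v := fun g hg => (h g hg).symm

theorem trans {u : ClockVal C} (h : RegionEquiv K v w) (h' : RegionEquiv K w u) :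
    RegionEquiv K v u :=
  fun g hg => (h g hg).trans (h' g hg)

theorem clock (h : RegionEquiv K v w) (x : C) (r : Cmp) {c : ℕ} (hc : c ≤ K) :
    r.Holds (v x : ℝ) c ↔ r.Holds (w x : ℝ) c :=
  h (.clock x r c) hc

theorem diag (h : RegionEquiv K v w) (x y : C) (r : Cmp) {c : ℤ} (hc : |c| ≤ K) :
    r.Holds ((v x : ℝ) - v y) c ↔ r.Holds ((w x : ℝ) - w y) c :=
  h (.diag x y r c) hc

theorem sat_iff (h : RegionEquiv K v w) {g : ClockConstraint C} (hg : g.maxConst ≤ K) :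
    g.Sat v ↔ g.Sat w := by
  induction g with
  | atom x r c => exact h.clock x r hg
  | and g₁ g₂ ih₁ ih₂ =>
    exact and_congr (ih₁ ((le_max_left _ _).trans hg)) (ih₂ ((le_max_right _ _).trans hg))

/-- Resetting one clock of a diagonal atom leaves a single clock compared with a possibly negative
integer. Clock atoms decide the nonnegative constants; negative ones are decided by clocks being
nonnegative. -/
theorem clock_int_le (h : RegionEquiv K v w) (x : C) {c : ℤ} (hc : |c| ≤ K) :
    ((v x : ℝ) ≤ c ↔ (w x : ℝ) ≤ c) ∧ ((c : ℝ) ≤ v x ↔ (c : ℝ) ≤ w x) := by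
  rcases le_or_gt 0 c with h0 | h0
  · lift c to ℕ using h0
    have hc' : c ≤ K := by simpa using hc
    simpa [Cmp.Holds] using And.intro (h.clock x .le hc') (h.clock x .ge hc')
  · have hc0 : (c : ℝ) < 0 := by exact_mod_cast h0
    have hv := (v x).2
    have hw := (w x).2
    exact ⟨iff_of_false (hc0.trans_le hv).not_ge (hc0.trans_le hw).not_ge,
      iff_of_true (hc0.le.trans hv) (hc0.le.trans hw)⟩

/-- After a reset, `x - y` equals the old `x - y`, `x`, `-y` or `0`, so the atom becomes a condition
on the old valuation with a constant of the same absolute value. -/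
theorem reset (h : RegionEquiv K v w) (s : Set C) : RegionEquiv K (v.reset s) (w.reset s) := by
  rintro (⟨x, r, c⟩ | ⟨x, y, r, c⟩) hg
  · by_cases hx : x ∈ s
    · simp [ZoneAtom.Sat, ClockVal.reset, hx]
    · simpa [ZoneAtom.Sat, ClockVal.reset, hx] using h.clock x r hg
  · by_cases hx : x ∈ s <;> by_cases hy : y ∈ s
    · simp [ZoneAtom.Sat, ClockVal.reset, hx, hy]
    -- Comparing `-y` with `c` amounts to comparing `y` with `-c`.
    · have hc : |(-c)| ≤ (K : ℤ) := by rw [abs_neg]; exact hg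
      obtain ⟨h1, h2⟩ := h.clock_int_le y hc
      push_cast at h1 h2
      simp only [ZoneAtom.Sat, ClockVal.reset, hx, hy, if_true, if_false, NNReal.coe_zero, zero_sub]
      exact Cmp.holds_congr (by rw [neg_le, h2, neg_le]) (by rw [le_neg, h1, le_neg]) r
    · obtain ⟨h1, h2⟩ := h.clock_int_le x hg
      simp only [ZoneAtom.Sat, ClockVal.reset, hx, hy, if_true, if_false, NNReal.coe_zero, sub_zero]
      exact Cmp.holds_congr h1 h2 r
    · simpa [ZoneAtom.Sat, ClockVal.reset, hx, hy] using h.diag x y r hg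

/-- Whether `x ⌣ c` holds after a delay `d` depends only on the position of `d` relative to the time
`c - v x`. The order of two such times is a diagonal condition with constant `c - e`, of absolute
value at most `K` as both constants lie in `[0, K]`; hence it is the same for `w`. Diagonal atoms do
not change under delay. -/
theorem exists_delay [Finite C] (h : RegionEquiv K v w) (d : ℝ≥0) :
    ∃ d' : ℝ≥0, RegionEquiv K (v.delay d) (w.delay d') := by
  -- The index `none` stands for time `0`: its order relative to the other times is given by clock
  -- atoms, and it forces `d'` to be nonnegative.
  let T (u : ClockVal C) : Option (C × Set.Iic K) → ℝ :=
    fun i => i.elim 0 fun t => ((t.2 : ℕ) : ℝ) - u t.1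
  have hT : ∀ i j, T v i ≤ T v j ↔ T w i ≤ T w j := by
    rintro (_ | ⟨x, c, hc⟩) (_ | ⟨y, e, he⟩)
    · simp [T]
    · simpa [T, Cmp.Holds] using h.clock y .le he
    · simpa [T, Cmp.Holds] using h.clock x .ge hc
    · have hce : |(c : ℤ) - e| ≤ K := by
        simp only [Set.mem_Iic] at hc he
        rw [abs_le]
        omega
      have := h.diag x y .ge hce
      simp only [Cmp.Holds, ge_iff_le] at this
      push_cast at this
      simp only [T, Option.elim]
      constructor <;> intro h'
      · linarith [this.1 (by linarith)]
      · linarith [this.2 (by linarith)]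
  obtain ⟨d', hd'⟩ := exists_same_position hT d
  have h0 : 0 ≤ d' := (hd' none).1.1 d.2
  lift d' to ℝ≥0 using h0
  refine ⟨d', ?_⟩
  rintro (⟨x, r, c⟩ | ⟨x, y, r, c⟩) hg
  · obtain ⟨h1, h2⟩ := hd' (some (x, ⟨c, hg⟩))
    simp only [T, Option.elim] at h1 h2
    simp only [ZoneAtom.Sat, ClockVal.delay, NNReal.coe_add]
    refine Cmp.holds_congr ?_ ?_ r
    · rw [← le_sub_iff_add_le', h2, le_sub_iff_add_le']
    · rw [← sub_le_iff_le_add', h1, sub_le_iff_le_add']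
  · simpa [ZoneAtom.Sat, ClockVal.delay] using h.diag x y r hg

end RegionEquiv

/-- The region of a valuation. -/
def region {C : Type*} (K : ℕ) (v : ClockVal C) : Set (ClockVal C) :=
  {w | RegionEquiv K v w}

section Region

variable {C : Type*} {K : ℕ}

/-- The bounded atoms that hold at a valuation define its region. -/
theorem mem_region_iff {v w : ClockVal C} :
    w ∈ region K v ↔ ∀ g : ZoneAtom C, g.Bounded K → g.Sat v → g.Sat w := by
  refine ⟨fun h g hg => (h g hg).1, fun h g hg => ⟨h g hg, fun hw => ?_⟩⟩
  -- Exactly one of `<`, `=`, `>` holds at `v`; it carries over to `w` and fixes the truth of all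
  -- five symbols there. Hence implication in one direction suffices.
  have key : ∀ (r : Cmp) (a a' b : ℝ), (∀ r : Cmp, r.Holds a b → r.Holds a' b) →
      r.Holds a' b → r.Holds a b := by
    intro r a a' b H
    have h1 := H .lt
    have h2 := H .eq
    have h3 := H .gt
    simp only [Cmp.Holds] at h1 h2 h3
    rcases lt_trichotomy a b with hab | hab | hab
    · have := h1 hab
      cases r <;> simp only [Cmp.Holds] <;> intro <;> linarith
    · have := h2 hab
      cases r <;> simp only [Cmp.Holds] <;> intro <;> linarith
    · have := h3 hab
      cases r <;> simp only [Cmp.Holds] <;> intro <;> linarith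
  cases g with
  | clock x r c => exact key r _ _ _ (fun r' => h (.clock x r' c) hg) hw
  | diag x y r c => exact key r _ _ _ (fun r' => h (.diag x y r' c) hg) hw

theorem region_eq_of_equiv {v w : ClockVal C} (h : RegionEquiv K v w) :
    region K v = region K w :=
  Set.ext fun _ => ⟨fun h' => h.symm.trans h', fun h' => h.trans h'⟩

theorem convex_region (v : ClockVal C) : Convex ℝ≥0 (region K v) := by
  have : region K v =
      ⋂ (g : ZoneAtom C) (_ : g.Bounded K) (_ : g.Sat v), {w | g.Sat w} := by
    ext w
    simp [mem_region_iff]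
  rw [this]
  exact convex_iInter fun g => convex_iInter fun _ => convex_iInter fun _ => g.convex_sat

theorem isZone_region [Finite C] (v : ClockVal C) : IsZone (region K v) := by
  have hfin : {g : ZoneAtom C | g.Bounded K ∧ g.Sat v}.Finite :=
    (ZoneAtom.finite_bounded K).subset fun _ h => h.1
  refine ⟨[hfin.toFinset.toList], ?_⟩
  ext w
  simp [mem_region_iff]

/-- A region is determined by the subset of the finitely many bounded atoms that hold on it. -/
theorem finite_regions [Finite C] (K : ℕ) : (Set.range (region (C := C) K)).Finite := by
  have hfin := (ZoneAtom.finite_bounded (C := C) K).finite_subsets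
  refine (hfin.image fun s => {w | ∀ g ∈ s, g.Sat w}).subset ?_
  rintro _ ⟨v, rfl⟩
  refine ⟨{g | g.Bounded K ∧ g.Sat v}, fun _ h => h.1, ?_⟩
  ext w
  simp [mem_region_iff]

end Region

/-! ### The region graph -/

namespace TimedAutomaton

variable {L C Act : Type*} {A : TimedAutomaton L C Act}

/-- All guards and invariants of the automaton have constants at most `K`. -/
def ConstBounded (A : TimedAutomaton L C Act) (K : ℕ) : Prop :=
  (∀ l, (A.inv l).maxConst ≤ K) ∧ ∀ e ∈ A.edges, e.guard.maxConst ≤ K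

theorem exists_constBounded [Finite L] (A : TimedAutomaton L C Act) :
    ∃ K, A.ConstBounded K := by
  obtain ⟨K₁, h₁⟩ := (Set.finite_range fun l => (A.inv l).maxConst).bddAbove
  obtain ⟨K₂, h₂⟩ := (A.edges_finite.image fun e => e.guard.maxConst).bddAbove
  exact ⟨max K₁ K₂, fun l => (h₁ ⟨l, rfl⟩).trans (le_max_left _ _),
    fun e he => (h₂ ⟨e, he, rfl⟩).trans (le_max_right _ _)⟩

/-- Equal location with region equivalence is itself a bisimulation: guards and target invariants
have constants at most `K`, so equivalent valuations agree on them. The relation is symmetric, so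
matching in one direction is enough. -/
theorem ConstBounded.bisimilar [Finite C] {K : ℕ} (hK : A.ConstBounded K) {p q : A.Proc}
    (hloc : p.loc = q.loc) (hval : RegionEquiv K p.val q.val) : TimeAbstractedBisimilar p q := by
  have act : ∀ p q : A.Proc, p.loc = q.loc → RegionEquiv K p.val q.val → ∀ a p',
      A.ActStep p a p' → ∃ q', A.ActStep q a q' ∧ p'.loc = q'.loc ∧
        RegionEquiv K p'.val q'.val := by
    rintro p q hl hv a p' ⟨e, he, hs, ha, ht, hg, hr⟩
    have hv' : RegionEquiv K p'.val (q.val.reset e.resets) := hr ▸ hv.reset e.resets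
    exact ⟨⟨p'.loc, q.val.reset e.resets, (hv'.sat_iff (hK.1 _)).1 p'.sat_inv⟩,
      ⟨e, he, hs.trans hl, ha, ht, (hv.sat_iff (hK.2 e he)).1 hg, rfl⟩, rfl, hv'⟩
  have delay : ∀ p q : A.Proc, p.loc = q.loc → RegionEquiv K p.val q.val → ∀ d p',
      A.DelayStep p d p' → ∃ d' q', A.DelayStep q d' q' ∧ p'.loc = q'.loc ∧
        RegionEquiv K p'.val q'.val := by
    rintro p q hl hv d p' ⟨hl', hd⟩
    obtain ⟨d', h⟩ := hv.exists_delay d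
    rw [← hd] at h
    exact ⟨d', ⟨p'.loc, q.val.delay d', (h.sat_iff (hK.1 _)).1 p'.sat_inv⟩,
      ⟨hl'.trans hl, rfl⟩, rfl, h⟩
  refine ⟨fun p q => p.loc = q.loc ∧ RegionEquiv K p.val q.val, ⟨?_, ?_, ?_, ?_⟩, hloc, hval⟩
  · rintro p q ⟨hl, hv⟩
    exact act p q hl hv
  · rintro p q ⟨hl, hv⟩ a q' hq
    obtain ⟨p', hp, hl', hv'⟩ := act q p hl.symm hv.symm a q' hq
    exact ⟨p', hp, hl'.symm, hv'.symm⟩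
  · rintro p q ⟨hl, hv⟩
    exact delay p q hl hv
  · rintro p q ⟨hl, hv⟩ d q' hq
    obtain ⟨d', p', hp, hl', hv'⟩ := delay q p hl.symm hv.symm d q' hq
    exact ⟨d', p', hp, hl'.symm, hv'.symm⟩

/-- The node of the region graph in which a process lies. -/
def regionNode (K : ℕ) (r : A.Proc) : ZoneNode L C :=
  ⟨{r.loc}, region K r.val⟩

theorem regionNode_contains_self (K : ℕ) (r : A.Proc) : (regionNode K r).Contains r :=
  ⟨rfl, RegionEquiv.refl _⟩

theorem regionNode_eq_of_contains {K : ℕ} {r r' : A.Proc} (h : (regionNode K r).Contains r') :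
    regionNode K r = regionNode K r' := by
  obtain ⟨hl, hv⟩ := h
  rw [regionNode, regionNode, region_eq_of_equiv hv, Set.mem_singleton_iff.1 hl]

/-- The graph of the regions that contain a process reachable from `p`. -/
def regionGraph [Finite C] (K : ℕ) (p : A.Proc) : ZoneGraph L C Act where
  nodes := regionNode K '' {r | A.Reachable p r}
  init := ⟨regionNode K p, p, Relation.ReflTransGen.refl, rfl⟩
  step s a t := match a with
    | .act a => ∃ r ∈ s.1.procs p, ∃ r' ∈ t.1.procs p, A.ActStep r a r'
    | .eps => Relation.ReflTransGen (fun s' t' : regionNode K '' {r | A.Reachable p r} =>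
        ∃ r ∈ s'.1.procs p, ∃ r' ∈ t'.1.procs p, ∃ d, A.DelayStep r d r') s t
  isZone := by
    rintro _ ⟨r, -, rfl⟩
    exact isZone_region r.val

theorem represents_regionGraph [Finite L] [Finite C] {K : ℕ} (hK : A.ConstBounded K)
    (p : A.Proc) : Represents A p (regionGraph K p) where
  finite := by
    refine ((Set.finite_univ (α := L)).prod (finite_regions (C := C) K)).image
      (fun t => (⟨{t.1}, t.2⟩ : ZoneNode L C)) |>.subset ?_
    rintro _ ⟨r, -, rfl⟩
    exact ⟨(r.loc, region K r.val), ⟨trivial, r.val, rfl⟩, rfl⟩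
  convex := by
    rintro _ ⟨r, -, rfl⟩
    exact convex_region r.val
  init_contains := regionNode_contains_self K p
  bisimilar := by
    rintro _ ⟨r₀, -, rfl⟩ r r' ⟨hl, hv⟩ ⟨hl', hv'⟩
    exact hK.bisimilar (Eq.trans hl (Eq.symm hl')) (RegionEquiv.trans (RegionEquiv.symm hv) hv')
  cover := by
    intro r hr
    refine ⟨⟨regionNode K r, r, hr, rfl⟩, regionNode_contains_self K r, ?_⟩
    rintro ⟨_, r', _, rfl⟩ h
    exact Subtype.ext (regionNode_eq_of_contains h)
  step_act _ _ _ := Iff.rfl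
  step_eps _ _ := Iff.rfl
  connected := by
    rintro ⟨_, r, hr, rfl⟩
    have hr' : A.Reachable p r := hr
    induction hr' with
    | refl => exact Relation.ReflTransGen.refl
    | @tail r r' h h' ih =>
      refine (ih h).tail ?_
      rcases h' with ⟨a, h'⟩ | ⟨d, h'⟩
      · exact ⟨.act a, r, ⟨h, regionNode_contains_self K r⟩, r',
          ⟨hr, regionNode_contains_self K r'⟩, h'⟩
      · exact ⟨.eps, Relation.ReflTransGen.single ⟨r, ⟨h, regionNode_contains_self K r⟩, r',
          ⟨hr, regionNode_contains_self K r'⟩, d, h'⟩⟩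

end TimedAutomaton

/-! ### Existence of zone valuation graphs -/

namespace Represents

variable {L C Act : Type*} {A : TimedAutomaton L C Act} {p : A.Proc} {Z : ZoneGraph L C Act}

theorem init_mem_procs (hZ : Represents A p Z) : p ∈ Z.init.1.procs p :=
  ⟨Relation.ReflTransGen.refl, hZ.init_contains⟩

/-- Connectedness excludes empty nodes: the initial node contains `p`, and the end of any edge
contains the target of a witnessing transition, unless the edge is a reflexive `ε`-loop. -/
theorem procs_nonempty (hZ : Represents A p Z) (s : Z.nodes) : (s.1.procs p).Nonempty := by
  induction hZ.connected s with
  | refl => exact ⟨p, hZ.init_mem_procs⟩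
  | tail _ h ih =>
    obtain ⟨a | _, h⟩ := h
    · obtain ⟨_, _, r', hr', _⟩ := (hZ.step_act _ _ _).1 h
      exact ⟨r', hr'⟩
    · rcases ((hZ.step_eps _ _).1 h).cases_tail with rfl | ⟨_, _, _, _, r', hr', _⟩
      · exact ih
      · exact ⟨r', hr'⟩

/-- A process in `t` also lies in some node `s` of `Z`, hence in `f s`; as it lies in only one node
of `Z'`, `f s = t`. -/
theorem surjective_of_procs_subset (hZ : Represents A p Z) {Z' : ZoneGraph L C Act}
    (hZ' : Represents A p Z') {f : Z.nodes → Z'.nodes}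
    (hf : ∀ s, s.1.procs p ⊆ (f s).1.procs p) : Function.Surjective f := by
  intro t
  obtain ⟨r, hr, hrt⟩ := hZ'.procs_nonempty t
  obtain ⟨s, hs, -⟩ := hZ.cover r hr
  exact ⟨s, (hZ'.cover r hr).unique (hf s ⟨hr, hs⟩).2 hrt⟩

end Represents

/-- In a representation with the fewest nodes, a comparison map `f` is surjective onto at least as
many nodes, hence bijective. -/
theorem exists_isZoneValuationGraph {L C Act : Type*} [Finite L] [Finite C]
    (A : TimedAutomaton L C Act) (p : A.Proc) : ∃ Z, IsZoneValuationGraph A p Z := by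
  obtain ⟨K, hK⟩ := A.exists_constBounded
  have hne : ∃ n, ∃ Z, Represents A p Z ∧ Z.nodes.ncard = n :=
    ⟨_, _, TimedAutomaton.represents_regionGraph hK p, rfl⟩
  classical
  obtain ⟨Z, hZ, hcard⟩ := Nat.find_spec hne
  refine ⟨Z, hZ, fun Z' hZ' f hf => ?_⟩
  have := hZ.finite.to_subtype
  have := hZ'.finite.to_subtype
  have hle : Nat.card Z.nodes ≤ Nat.card Z'.nodes := by
    rw [Nat.card_coe_set_eq, Nat.card_coe_set_eq, hcard]
    exact Nat.find_min' hne ⟨Z', hZ', rfl⟩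
  have hsurj := hZ.surjective_of_procs_subset hZ' hf
  exact ((Nat.bijective_iff_surjective_and_card f).2
    ⟨hsurj, hle.antisymm (Nat.card_le_card_of_surjective f hsurj)⟩).1

/-! ### The game -/

namespace BisimGame

variable {L₁ C₁ L₂ C₂ Act : Type*} {Z₁ : ZoneGraph L₁ C₁ Act} {Z₂ : ZoneGraph L₂ C₂ Act}

/-- The defender wins exactly if the initial position lies in a set of positions in which it can
always answer without leaving the set. -/
theorem defenderWins_iff : DefenderWins Z₁ Z₂ ↔
    ∃ W : Position Z₁ Z₂ → Prop, W (Z₁.init, Z₂.init) ∧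
      ∀ pos m, W pos → Legal pos m → ∃ pos', Answers pos m pos' ∧ W pos' := by
  classical
  constructor
  · rintro ⟨σ, hσ⟩
    -- The invariant consists of the positions that occur in plays following `σ`.
    refine ⟨fun pos => ∃ h, Play σ h pos, ⟨[], .start⟩, ?_⟩
    rintro pos m ⟨h, hp⟩ hm
    exact ⟨_, hσ h pos m hp hm, _, .round hp hm⟩
  · rintro ⟨W, h0, hW⟩
    -- A strategy looking only at the latest round. Its values at the empty history and outside the
    -- invariant are never used in a play.
    let σ : Strategy Z₁ Z₂ := fun h => match h with
      | [] => (Z₁.init, Z₂.init)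
      | (pos, m) :: _ => if H : ∃ pos', Answers pos m pos' ∧ W pos' then H.choose else pos
    have hσ : ∀ h pos m, W pos → Legal pos m →
        Answers pos m (σ ((pos, m) :: h)) ∧ W (σ ((pos, m) :: h)) := by
      intro h pos m hp hm
      have H := hW pos m hp hm
      simp only [σ, dif_pos H]
      exact H.choose_spec
    have hinv : ∀ h pos, Play σ h pos → W pos := by
      intro h pos hp
      induction hp with
      | start => exact h0
      | @round h pos m _ hm ih => exact (hσ h pos m ih hm).2
    exact ⟨σ, fun h pos m hp hm => (hσ h pos m (hinv h pos hp) hm).1⟩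

end BisimGame

/-! ### Edges of representations versus transitions of processes -/

namespace Represents

variable {L₁ C₁ L₂ C₂ Act : Type*} {A₁ : TimedAutomaton L₁ C₁ Act}
  {A₂ : TimedAutomaton L₂ C₂ Act} {p : A₁.Proc} {q : A₂.Proc}
  {Z₁ : ZoneGraph L₁ C₁ Act} {Z₂ : ZoneGraph L₂ C₂ Act}

theorem bisimilar_of_mem (hZ : Represents A₁ p Z₁) {s : Z₁.nodes} {r r' : A₁.Proc}
    (h : r ∈ s.1.procs p) (h' : r' ∈ s.1.procs p) : TimeAbstractedBisimilar r r' :=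
  hZ.bisimilar s.1 s.2 r r' h.2 h'.2

/-- Edges of the graph are matched by transitions of processes bisimilar to a process of the
source. -/
theorem exists_actStep (hZ : Represents A₁ p Z₁) {s t : Z₁.nodes} {a : Act}
    (h : Z₁.step s (.act a) t) {r : A₁.Proc} (hr : r ∈ s.1.procs p) {u : A₂.Proc}
    (hu : TimeAbstractedBisimilar r u) :
    ∃ r' ∈ t.1.procs p, ∃ u', A₂.ActStep u a u' ∧ TimeAbstractedBisimilar r' u' := by
  obtain ⟨r₀, hr₀, r₁, hr₁, hs⟩ := (hZ.step_act s t a).1 h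
  obtain ⟨u', hu', hb⟩ := timeAbstractedBisimilar_isBisimulation.act_left r₀ u
    ((hZ.bisimilar_of_mem hr₀ hr).trans hu) a r₁ hs
  exact ⟨r₁, hr₁, u', hu', hb⟩

/-- The links of an `ε`-edge may come from different processes of the intermediate nodes, so they
need not compose. Each link is imitated starting from where `u` has already arrived, and the delays
of `u` do compose. -/
theorem exists_delayStep (hZ : Represents A₁ p Z₁) {s t : Z₁.nodes}
    (h : Z₁.step s .eps t) {r : A₁.Proc} (hr : r ∈ s.1.procs p) {u : A₂.Proc}
    (hu : TimeAbstractedBisimilar r u) :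
    ∃ r' ∈ t.1.procs p, ∃ d u', A₂.DelayStep u d u' ∧ TimeAbstractedBisimilar r' u' := by
  induction (hZ.step_eps s t).1 h with
  | refl => exact ⟨r, hr, 0, u, .zero u, hu⟩
  | tail hst hstep ih =>
    obtain ⟨r', hr', d, u', hd, hb⟩ := ih ((hZ.step_eps _ _).2 hst)
    obtain ⟨r₀, hr₀, r₁, hr₁, e, hs⟩ := hstep
    obtain ⟨e', u'', he, hb'⟩ := timeAbstractedBisimilar_isBisimulation.delay_left r₀ u'
      ((hZ.bisimilar_of_mem hr₀ hr').trans hb) e r₁ hs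
    exact ⟨r₁, hr₁, _, u'', hd.trans he, hb'⟩

/-- Edges are matched by edges of a graph with a bisimilar process. -/
theorem exists_step (hZ₁ : Represents A₁ p Z₁) (hZ₂ : Represents A₂ q Z₂) {s s' : Z₁.nodes}
    {t : Z₂.nodes} {a : Lep Act} (h : Z₁.step s a s') {r : A₁.Proc} (hr : r ∈ s.1.procs p)
    {u : A₂.Proc} (hu : u ∈ t.1.procs q) (hb : TimeAbstractedBisimilar r u) :
    ∃ t', Z₂.step t a t' ∧ ∃ r' ∈ s'.1.procs p, ∃ u' ∈ t'.1.procs q,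
      TimeAbstractedBisimilar r' u' := by
  cases a with
  | act a =>
    obtain ⟨r', hr', u', hs, hb'⟩ := hZ₁.exists_actStep h hr hb
    obtain ⟨t', ht', -⟩ := hZ₂.cover u' (hu.1.act hs)
    exact ⟨t', (hZ₂.step_act _ _ _).2 ⟨u, hu, u', ⟨hu.1.act hs, ht'⟩, hs⟩,
      r', hr', u', ⟨hu.1.act hs, ht'⟩, hb'⟩
  | eps =>
    obtain ⟨r', hr', d, u', hs, hb'⟩ := hZ₁.exists_delayStep h hr hb
    obtain ⟨t', ht', -⟩ := hZ₂.cover u' (hu.1.delay hs)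
    exact ⟨t', (hZ₂.step_eps _ _).2 (.single ⟨u, hu, u', ⟨hu.1.delay hs, ht'⟩, d, hs⟩),
      r', hr', u', ⟨hu.1.delay hs, ht'⟩, hb'⟩

/-- The defender keeps the invariant that the two current nodes contain reachable processes
bisimilar to each other. -/
theorem defenderWins_of_bisimilar (hZ₁ : Represents A₁ p Z₁) (hZ₂ : Represents A₂ q Z₂)
    (h : TimeAbstractedBisimilar p q) : BisimGame.DefenderWins Z₁ Z₂ := by
  rw [BisimGame.defenderWins_iff]
  refine ⟨fun pos => ∃ r ∈ pos.1.1.procs p, ∃ u ∈ pos.2.1.procs q, TimeAbstractedBisimilar r u,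
    ⟨p, hZ₁.init_mem_procs, q, hZ₂.init_mem_procs, h⟩, ?_⟩
  rintro ⟨s, t⟩ (⟨a, s'⟩ | ⟨a, t'⟩) ⟨r, hr, u, hu, hb⟩ hm
  · obtain ⟨t', ht', h'⟩ := hZ₁.exists_step hZ₂ hm hr hu hb
    exact ⟨(s', t'), ⟨rfl, ht'⟩, h'⟩
  · obtain ⟨s', hs', u', hu', r', hr', h'⟩ := hZ₂.exists_step hZ₁ hm hu hr hb.symm
    exact ⟨(s', t'), ⟨rfl, hs'⟩, r', hr', u', hu', h'.symm⟩

theorem exists_step_act (hZ : Represents A₁ p Z₁) {s : Z₁.nodes} {r r' : A₁.Proc} {a : Act}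
    (hr : r ∈ s.1.procs p) (h : A₁.ActStep r a r') :
    ∃ s', Z₁.step s (.act a) s' ∧ r' ∈ s'.1.procs p := by
  obtain ⟨s', hs', -⟩ := hZ.cover r' (hr.1.act h)
  exact ⟨s', (hZ.step_act _ _ _).2 ⟨r, hr, r', ⟨hr.1.act h, hs'⟩, h⟩, hr.1.act h, hs'⟩

theorem exists_step_eps (hZ : Represents A₁ p Z₁) {s : Z₁.nodes} {r r' : A₁.Proc} {d : ℝ≥0}
    (hr : r ∈ s.1.procs p) (h : A₁.DelayStep r d r') :
    ∃ s', Z₁.step s .eps s' ∧ r' ∈ s'.1.procs p := by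
  obtain ⟨s', hs', -⟩ := hZ.cover r' (hr.1.delay h)
  exact ⟨s', (hZ.step_eps _ _).2 (.single ⟨r, hr, r', ⟨hr.1.delay h, hs'⟩, d, h⟩),
    hr.1.delay h, hs'⟩

theorem bisimilar_of_defenderWins (hZ₁ : Represents A₁ p Z₁) (hZ₂ : Represents A₂ q Z₂)
    (h : BisimGame.DefenderWins Z₁ Z₂) : TimeAbstractedBisimilar p q := by
  obtain ⟨W, h0, hW⟩ := BisimGame.defenderWins_iff.1 h
  have hleft : ∀ {s t a s'}, W (s, t) → Z₁.step s a s' → ∃ t', Z₂.step t a t' ∧ W (s', t') := by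
    intro s t a s' hst hs
    obtain ⟨⟨_, t'⟩, ⟨rfl, ht⟩, hw⟩ := hW (s, t) (.left a s') hst hs
    exact ⟨t', ht, hw⟩
  have hright : ∀ {s t a t'}, W (s, t) → Z₂.step t a t' →
      ∃ s', Z₁.step s a s' ∧ W (s', t') := by
    intro s t a t' hst ht
    obtain ⟨⟨s', _⟩, ⟨rfl, hs⟩, hw⟩ := hW (s, t) (.right a t') hst ht
    exact ⟨s', hs, hw⟩
  -- Closing under bisimilarity is needed because a class may be split among several nodes: the
  -- transition of `u` imitating the defender's edge to `t'` may end outside `t'`, but it ends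
  -- bisimilar to a process of `t'`.
  refine ⟨fun r u => ∃ s t, W (s, t) ∧ (∃ r₀ ∈ s.1.procs p, TimeAbstractedBisimilar r₀ r) ∧
    ∃ u₀ ∈ t.1.procs q, TimeAbstractedBisimilar u₀ u, ⟨?_, ?_, ?_, ?_⟩,
    Z₁.init, Z₂.init, h0, ⟨p, hZ₁.init_mem_procs, .refl p⟩, q, hZ₂.init_mem_procs, .refl q⟩
  · rintro r u ⟨s, t, hst, ⟨r₀, hr₀, hr⟩, u₀, hu₀, hu⟩ a r' hs
    obtain ⟨r₁, hs₁, hb⟩ := timeAbstractedBisimilar_isBisimulation.act_right r₀ r hr a r' hs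
    obtain ⟨s', hs', hr₁⟩ := hZ₁.exists_step_act hr₀ hs₁
    obtain ⟨t', ht', hw⟩ := hleft hst hs'
    obtain ⟨u₁, hu₁, u', hu', hb'⟩ := hZ₂.exists_actStep ht' hu₀ hu
    exact ⟨u', hu', s', t', hw, ⟨r₁, hr₁, hb⟩, u₁, hu₁, hb'⟩
  · rintro r u ⟨s, t, hst, ⟨r₀, hr₀, hr⟩, u₀, hu₀, hu⟩ a u' hs
    obtain ⟨u₁, hs₁, hb⟩ := timeAbstractedBisimilar_isBisimulation.act_right u₀ u hu a u' hs
    obtain ⟨t', ht', hu₁⟩ := hZ₂.exists_step_act hu₀ hs₁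
    obtain ⟨s', hs', hw⟩ := hright hst ht'
    obtain ⟨r₁, hr₁, r', hr', hb'⟩ := hZ₁.exists_actStep hs' hr₀ hr
    exact ⟨r', hr', s', t', hw, ⟨r₁, hr₁, hb'⟩, u₁, hu₁, hb⟩
  · rintro r u ⟨s, t, hst, ⟨r₀, hr₀, hr⟩, u₀, hu₀, hu⟩ d r' hs
    obtain ⟨_, r₁, hs₁, hb⟩ := timeAbstractedBisimilar_isBisimulation.delay_right r₀ r hr d r' hs
    obtain ⟨s', hs', hr₁⟩ := hZ₁.exists_step_eps hr₀ hs₁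
    obtain ⟨t', ht', hw⟩ := hleft hst hs'
    obtain ⟨u₁, hu₁, d', u', hu', hb'⟩ := hZ₂.exists_delayStep ht' hu₀ hu
    exact ⟨d', u', hu', s', t', hw, ⟨r₁, hr₁, hb⟩, u₁, hu₁, hb'⟩
  · rintro r u ⟨s, t, hst, ⟨r₀, hr₀, hr⟩, u₀, hu₀, hu⟩ d u' hs
    obtain ⟨_, u₁, hs₁, hb⟩ := timeAbstractedBisimilar_isBisimulation.delay_right u₀ u hu d u' hs
    obtain ⟨t', ht', hu₁⟩ := hZ₂.exists_step_eps hu₀ hs₁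
    obtain ⟨s', hs', hw⟩ := hright hst ht'
    obtain ⟨r₁, hr₁, d', r', hr', hb'⟩ := hZ₁.exists_delayStep hs' hr₀ hr
    exact ⟨d', r', hr', s', t', hw, ⟨r₁, hr₁, hb'⟩, u₁, hu₁, hb⟩

end Represents

theorem mainTheorem6 {L₁ C₁ L₂ C₂ Act : Type*}
    [Finite L₁] [Finite C₁] [Finite L₂] [Finite C₂] [Finite Act]
    (A₁ : TimedAutomaton L₁ C₁ Act) (A₂ : TimedAutomaton L₂ C₂ Act)
    (p : A₁.Proc) (q : A₂.Proc) :
    (∃ Z₁, IsZoneValuationGraph A₁ p Z₁) ∧ (∃ Z₂, IsZoneValuationGraph A₂ q Z₂) ∧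
    ∀ (Z₁ : ZoneGraph L₁ C₁ Act) (Z₂ : ZoneGraph L₂ C₂ Act),
      IsZoneValuationGraph A₁ p Z₁ → IsZoneValuationGraph A₂ q Z₂ →
      (BisimGame.DefenderWins Z₁ Z₂ ↔ TimeAbstractedBisimilar p q) :=
  ⟨exists_isZoneValuationGraph A₁ p, exists_isZoneValuationGraph A₂ q, fun _ _ h₁ h₂ =>
    ⟨h₁.represents.bisimilar_of_defenderWins h₂.represents,
      h₁.represents.defenderWins_of_bisimilar h₂.represents⟩⟩
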